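/- Let $\Delta$ be a semiregular right-angled building over a finite index set $I$; that is, $\Delta$ is a building of type $M=(m_{ij})_{i,j\in I}$ with $m_{ij}\in\{2,\infty\}$ for all distinct $i,j\in I$, and for each $i\in I$ all $i$-panels of $\Delta$ have the same (possibly infinite) cardinality $q_i\geq 2$. Then any finite set of chambers of $\Delta$ is contained in a finite convex set of chambers. Here a set of chambers is convex if it contains all chambers of every minimal gallery between two of its members. -/

import Mathlib

universe u v

/-- A Coxeter matrix is right-angled if `m i j` is `2` or `∞` for all distinct `i`, `j`.
In Mathlib the entry `∞` of a Coxeter matrix is encoded as `0`. -/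
def CoxeterMatrix.IsRightAngled {I : Type*} (M : CoxeterMatrix I) : Prop :=
  ∀ i j : I, i ≠ j → M i j = 2 ∨ M i j = 0

/-- A chamber system over `I` with set of chambers `C`: every `i : I` determines an equivalence
relation on `C`, whose classes are the `i`-panels. -/
structure ChamberSystem (I C : Type*) where
  /-- The partition of the chambers into `i`-panels. -/
  panelSetoid : I → Setoid C

namespace ChamberSystem

variable {I C : Type*}

/-- The `i`-panel containing the chamber `c`. -/
def panel (S : ChamberSystem I C) (i : I) (c : C) : Set C :=
  {d | (S.panelSetoid i) c d}

/-- `i`-adjacency: two distinct chambers in a common `i`-panel. -/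
def Adj (S : ChamberSystem I C) (i : I) (c d : C) : Prop :=
  c ≠ d ∧ (S.panelSetoid i) c d

/-- `S.IsGallery c f γ d`: the list of chambers `γ` (which includes both ends) is a gallery
of type `f` from `c` to `d`. -/
inductive IsGallery (S : ChamberSystem I C) : C → List I → List C → C → Prop
  | nil (c : C) : IsGallery S c [] [c] c
  | cons {i : I} {f : List I} {c d e : C} {γ : List C} :
      S.Adj i c d → IsGallery S d f γ e → IsGallery S c (i :: f) (c :: γ) e

/-- `γ` is a minimal gallery from `c` to `d`: no gallery from `c` to `d` has fewer chambers. -/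
def IsMinimalGallery (S : ChamberSystem I C) (c : C) (γ : List C) (d : C) : Prop :=
  (∃ f : List I, S.IsGallery c f γ d) ∧
    ∀ (f' : List I) (γ' : List C), S.IsGallery c f' γ' d → γ.length ≤ γ'.length

/-- A set of chambers is convex if it contains all chambers of every minimal gallery whose two
ends lie in the set. -/
def IsConvex (S : ChamberSystem I C) (B : Set C) : Prop :=
  ∀ c ∈ B, ∀ d ∈ B, ∀ γ : List C, S.IsMinimalGallery c γ d → ∀ e ∈ γ, e ∈ B

/-- `S` is semiregular with parameters `q`: each `q i` is at least `2`, and all `i`-panels have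
the same, possibly infinite, cardinality `q i`. -/
def IsSemiregular {C : Type v} (S : ChamberSystem I C) (q : I → Cardinal.{v}) : Prop :=
  ∀ i : I, 2 ≤ q i ∧ ∀ c : C, Cardinal.mk (S.panel i c) = q i

end ChamberSystem

/-- A building of type `M`: a chamber system over `I` in which every panel has at least two
chambers, with a distance function `δ` to the Coxeter group of `M` such that, for each reduced
word `f`, one has `δ c d = r_f` if and only if there is a gallery of type `f` from `c` to `d`. -/
structure Building {I : Type*} (M : CoxeterMatrix I) (C : Type*) extends ChamberSystem I C where
  exists_adj : ∀ (i : I) (c : C), ∃ d : C, toChamberSystem.Adj i c d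
  /-- The Weyl distance. -/
  δ : C → C → M.Group
  δ_eq_iff : ∀ f : List I, M.toCoxeterSystem.IsReduced f → ∀ c d : C,
    δ c d = M.toCoxeterSystem.wordProd f ↔ ∃ γ : List C, toChamberSystem.IsGallery c f γ d

/-! Each panel partitions the chambers into branches according to their projections to it. If
adjacent chambers have distinct projections to a panel, then that panel defines the same partition
as the panel containing both chambers (`branchSetoid_eq_of_not`). This is where right angles enter:
a panel moves across squares of type `{i, k}` with `M i k = 2` until it meets the other one, without
changing its partition. So every step of a gallery crosses at most one partition, and only finitely
many partitions separate two given chambers.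

For nonempty `F`, let `B` consist of the chambers that, for every panel, share a branch with some
member of `F`. Minimal galleries cross no partition twice, so `B` is convex. A chamber is determined
by its branches (`eq_of_branchSetoid`), and a member of `B` has a choice only at the finitely many
partitions that separate members of `F`, where at most `F.ncard` branches are available. Hence `B`
is finite.

The Coxeter group input is that distinct left descents `i`, `k` of one element satisfy `M i k ≠ 0`.
-/

theorem Function.End.mul_apply_eq {α : Type*} (f g : Function.End α) (x : α) :
    (f * g) x = f (g x) := rfl

theorem Function.End.one_apply_eq {α : Type*} (x : α) : (1 : Function.End α) x = x := rfl

/-! ### Right-angled Coxeter groups: reflection cocycle and descents. -/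

namespace CoxeterSystem

open Classical in
/-- The action of a simple reflection on pairs of a group element and a sign, by conjugation, with
a change of sign at the simple reflection itself. -/
noncomputable def signedConj {I W : Type*} [Group W] {M : CoxeterMatrix I}
    (cs : CoxeterSystem M W) (i : I) : Function.End (W × ZMod 2) :=
  fun p => (cs.simple i * p.1 * cs.simple i, p.2 + if p.1 = cs.simple i then 1 else 0)

variable {I W : Type*} [Group W] {M : CoxeterMatrix I} (cs : CoxeterSystem M W)

theorem simple_commute_of_eq_two {i j : I} (h : M i j = 2) :
    cs.simple i * cs.simple j = cs.simple j * cs.simple i := by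
  have h1 := cs.simple_mul_simple_pow i j
  rw [h, pow_two] at h1
  have h2 := eq_inv_of_mul_eq_one_left h1
  simpa using h2

theorem simple_conj_eq_of_eq_two {i j : I} (h : M i j = 2) :
    cs.simple i * cs.simple j * cs.simple i = cs.simple j := by
  rw [cs.simple_commute_of_eq_two h, simple_mul_simple_cancel_right]

theorem conj_simple_eq_iff (i : I) (t u : W) :
    cs.simple i * t * cs.simple i = u ↔ t = cs.simple i * u * cs.simple i := by
  constructor
  · rintro rfl; simp [mul_assoc]
  · rintro rfl; simp [mul_assoc]

open Classical in
-- If `M i j = 2`, the conjugations commute and each sign change occurs twice; an infinite entry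
-- imposes no relation.
theorem isLiftable_signedConj (hM : M.IsRightAngled) : M.IsLiftable cs.signedConj := by
  intro i j
  have key : ∀ p : W × ZMod 2, (cs.signedConj i * cs.signedConj j) p =
      (cs.simple i * (cs.simple j * p.1 * cs.simple j) * cs.simple i,
        p.2 + (if p.1 = cs.simple j then 1 else 0) +
          if cs.simple j * p.1 * cs.simple j = cs.simple i then 1 else 0) := by
    intro p
    rfl
  have two : ∀ x : ZMod 2, x + x = 0 := by decide
  by_cases hij : i = j
  · subst hij
    rw [M.diagonal, pow_one]
    funext p
    rw [key]
    rw [Function.End.one_apply_eq]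
    refine Prod.ext (by simp [mul_assoc]) ?_
    have : cs.simple i * p.1 * cs.simple i = cs.simple i ↔ p.1 = cs.simple i := by
      rw [conj_simple_eq_iff]; simp
    simp only [this, add_assoc, two, add_zero]
  · rcases hM i j hij with h | h
    · rw [h, pow_two]
      funext p
      rw [Function.End.mul_apply_eq, key, key, Function.End.one_apply_eq]
      have hc := cs.simple_commute_of_eq_two h
      have hc' := cs.simple_conj_eq_of_eq_two h
      have h' : M j i = 2 := by rw [M.symmetric]; exact h
      have hd' := cs.simple_conj_eq_of_eq_two h'
      refine Prod.ext ?_ ?_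
      · simp only
        have : ∀ x, cs.simple i * (cs.simple j * x * cs.simple j) * cs.simple i
            = (cs.simple i * cs.simple j) * x * (cs.simple j * cs.simple i) := by
          intro x; simp only [mul_assoc]
        rw [this, this, ← hc]
        have h1 := cs.simple_mul_simple_pow i j
        rw [h, pow_two] at h1
        calc _ = ((cs.simple i * cs.simple j) * (cs.simple i * cs.simple j)) * p.1 *
            ((cs.simple i * cs.simple j) * (cs.simple i * cs.simple j)) := by
              simp only [mul_assoc]
          _ = p.1 := by rw [h1]; simp
      · simp only
        have e1 : cs.simple i * (cs.simple j * p.1 * cs.simple j) * cs.simple i = cs.simple j ↔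
            p.1 = cs.simple j := by
          rw [conj_simple_eq_iff, conj_simple_eq_iff, hc']; simp
        have e2 : cs.simple j * (cs.simple i * (cs.simple j * p.1 * cs.simple j) * cs.simple i)
            * cs.simple j = cs.simple i ↔ cs.simple j * p.1 * cs.simple j = cs.simple i := by
          rw [conj_simple_eq_iff, hd', conj_simple_eq_iff]; simp
        simp only [e1, e2]
        have four : ∀ x y z : ZMod 2, x + y + z + y + z = x := by decide
        exact four _ _ _
    · rw [h, pow_zero]

/-- The reflection cocycle of a right-angled Coxeter system: `cs.invCocycle hM w t` is the parity
of the number of times that a gallery from `1` to `w` crosses the wall of `t`. -/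
noncomputable def invCocycle (hM : M.IsRightAngled) (w t : W) : ZMod 2 :=
  (cs.lift ⟨cs.signedConj, cs.isLiftable_signedConj hM⟩ w⁻¹ (t, 0)).2

variable (hM : M.IsRightAngled)

theorem lift_signedConj_apply (w : W) : ∀ (t : W) (ε : ZMod 2),
    cs.lift ⟨cs.signedConj, cs.isLiftable_signedConj hM⟩ w (t, ε) =
      (w * t * w⁻¹, ε + cs.invCocycle hM w⁻¹ t) := by
  unfold invCocycle
  rw [inv_inv]
  induction w using cs.simple_induction_left with
  | one =>
    intro t ε
    rw [map_one]
    simp [Function.End.one_apply_eq]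
  | mul_simple_left w i ih =>
    intro t ε
    rw [map_mul, lift_apply_simple, Function.End.mul_apply_eq, Function.End.mul_apply_eq, ih t ε,
      ih t 0]
    simp [signedConj, mul_assoc, add_assoc]

theorem invCocycle_mul (v w t : W) :
    cs.invCocycle hM (v * w) t = cs.invCocycle hM v t + cs.invCocycle hM w (v⁻¹ * t * v) := by
  conv_lhs => unfold invCocycle
  rw [mul_inv_rev, map_mul, Function.End.mul_apply_eq, cs.lift_signedConj_apply hM,
    cs.lift_signedConj_apply hM]
  simp

theorem invCocycle_one (t : W) : cs.invCocycle hM 1 t = 0 := by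
  have := cs.invCocycle_mul hM 1 1 t
  simpa using this

open Classical in
theorem invCocycle_simple (i : I) (t : W) :
    cs.invCocycle hM (cs.simple i) t = if t = cs.simple i then 1 else 0 := by
  unfold invCocycle
  rw [inv_simple, lift_apply_simple]
  simp [signedConj]

theorem invCocycle_simple_self (i : I) :
    cs.invCocycle hM (cs.simple i) (cs.simple i) = 1 := by
  simp [invCocycle_simple]

/-- Strong exchange: odd parity forces some letter of `f` to cross the wall of `t`, and deleting
that letter multiplies the product by `t` on the left. -/
theorem exists_wordProd_eq_mul_of_invCocycle_eq_one (f : List I) :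
    ∀ t : W, cs.invCocycle hM (cs.wordProd f) t = 1 →
      ∃ g : List I, g.length + 1 = f.length ∧ cs.wordProd g = t * cs.wordProd f := by
  induction f with
  | nil => intro t ht; simp [invCocycle_one] at ht
  | cons i f ih =>
    intro t ht
    rw [wordProd_cons, invCocycle_mul, invCocycle_simple] at ht
    by_cases h : t = cs.simple i
    · refine ⟨f, by simp, ?_⟩
      rw [wordProd_cons, h, simple_mul_simple_cancel_left]
    · rw [if_neg h, zero_add, inv_simple] at ht
      obtain ⟨g, hg, hg'⟩ := ih _ ht
      refine ⟨i :: g, by simp [hg], ?_⟩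
      rw [wordProd_cons, hg', wordProd_cons]
      simp [mul_assoc]

theorem length_mul_lt_of_invCocycle_eq_one {w t : W} (h : cs.invCocycle hM w t = 1) :
    cs.length (t * w) < cs.length w := by
  obtain ⟨f, hf, rfl⟩ := cs.exists_isReduced w
  obtain ⟨g, hg, hg'⟩ := cs.exists_wordProd_eq_mul_of_invCocycle_eq_one hM f t h
  rw [← hg', hf.eq]
  have := cs.length_wordProd_le g
  omega

/-- Turns a comparison of lengths into a parity that `invCocycle_mul` computes. -/
theorem isLeftDescent_iff_invCocycle_eq_one {w : W} {i : I} :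
    cs.IsLeftDescent w i ↔ cs.invCocycle hM w (cs.simple i) = 1 := by
  refine ⟨fun h => ?_, fun h => cs.length_mul_lt_of_invCocycle_eq_one hM h⟩
  by_contra hne
  have h1 : cs.invCocycle hM (cs.simple i * w) (cs.simple i) = 1 := by
    rw [invCocycle_mul, invCocycle_simple_self, inv_simple, simple_mul_simple_self, one_mul]
    revert hne
    generalize cs.invCocycle hM w (cs.simple i) = x
    revert x
    decide
  have := cs.length_mul_lt_of_invCocycle_eq_one hM h1
  rw [simple_mul_simple_cancel_left] at this
  unfold IsLeftDescent at h
  omega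

theorem invCocycle_eq_zero_of_ne_one {w t : W} (h : cs.invCocycle hM w t ≠ 1) :
    cs.invCocycle hM w t = 0 := by
  revert h
  generalize cs.invCocycle hM w t = x
  revert x
  decide

include hM in
theorem isLeftDescent_simple_mul_iff_of_eq_two {i k : I} (h : M i k = 2) {w : W}
    (hne : cs.simple i ≠ cs.simple k) :
    cs.IsLeftDescent (cs.simple k * w) i ↔ cs.IsLeftDescent w i := by
  rw [cs.isLeftDescent_iff_invCocycle_eq_one hM, cs.isLeftDescent_iff_invCocycle_eq_one hM,
    invCocycle_mul, invCocycle_simple, if_neg hne, zero_add, inv_simple,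
    cs.simple_conj_eq_of_eq_two (by rw [M.symmetric]; exact h)]

include hM in
theorem simple_injective_of_isRightAngled : Function.Injective cs.simple := by
  classical
  intro i j hij
  by_contra hne
  -- The homomorphism to the group of order two that is nontrivial on `i` alone separates the two
  -- generators.
  let f : I → Multiplicative (ZMod 2) := fun k => Multiplicative.ofAdd (if k = i then 1 else 0)
  have hf : M.IsLiftable f := by
    intro a b
    have sq : ∀ x : Multiplicative (ZMod 2), x ^ 2 = 1 := by decide
    by_cases hab : a = b
    · subst hab
      rw [M.diagonal, pow_one, ← pow_two, sq]
    · rcases hM a b hab with h | h <;> rw [h]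
      · exact sq _
      · exact pow_zero _
  have h1 := cs.lift_apply_simple hf i
  have h2 := cs.lift_apply_simple hf j
  rw [hij, h2] at h1
  have : j ≠ i := fun h => hne h.symm
  simp only [f, if_pos, if_neg this] at h1
  revert h1
  decide

/-! ### Infinite dihedral subgroups. -/

section Dihedral

/-- The product of the alternating word of length `n` that begins with `i`. -/
def altProd (i k : I) : ℕ → W
  | 0 => 1
  | n + 1 => cs.simple i * altProd k i n

theorem exists_altProd_succ (n : ℕ) : ∀ i k : I,
    ∃ j, (j = i ∨ j = k) ∧ cs.altProd i k (n + 1) = cs.altProd i k n * cs.simple j := by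
  induction n with
  | zero => intro i k; exact ⟨i, Or.inl rfl, by simp [altProd]⟩
  | succ n ih =>
    intro i k
    obtain ⟨j, hj, h⟩ := ih k i
    exact ⟨j, hj.symm, by rw [altProd, h, altProd, mul_assoc]⟩

include hM in
theorem altProd_ne {i k : I} (hik : i ≠ k) (h : M i k = 0) (n : ℕ) :
    cs.altProd i k (n + 1) ≠ cs.altProd k i (n + 1) := by
  classical
  -- The infinite dihedral group acts on the integers by reflections in `1/2` and `-1/2`; the two
  -- alternating words of length `n` send `0` to `n` and `-n`.
  let f : I → Function.End ℤ := fun j x =>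
    if j = i then 1 - x else if j = k then -1 - x else x
  have sq : ∀ j, f j * f j = 1 := by
    intro j
    funext x
    rw [Function.End.mul_apply_eq, Function.End.one_apply_eq]
    simp only [f]
    split_ifs <;> ring
  have hf : M.IsLiftable f := by
    intro a b
    by_cases hab : a = b
    · rw [← hab, M.diagonal, pow_one, sq]
    · rcases hM a b hab with h2 | h0
      · have : f a = 1 ∨ f b = 1 := by
          by_contra! hcon
          have ha : a = i ∨ a = k := by
            by_contra! h'; exact hcon.1 (by funext x; simp [f, h', Function.End.one_apply_eq])
          have hb : b = i ∨ b = k := by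
            by_contra! h'; exact hcon.2 (by funext x; simp [f, h', Function.End.one_apply_eq])
          have hs : M k i = 0 := by rw [M.symmetric]; exact h
          rcases ha with rfl | rfl <;> rcases hb with rfl | rfl <;> simp_all
        rw [h2]
        rcases this with h1 | h1 <;> rw [h1] <;> simp [pow_two, sq]
      · rw [h0, pow_zero]
  have hpos : ∀ n : ℕ, cs.lift ⟨f, hf⟩ (cs.altProd i k n) 0 = n ∧
      cs.lift ⟨f, hf⟩ (cs.altProd k i n) 0 = -n := by
    intro n
    induction n with
    | zero => simp [altProd, Function.End.one_def]
    | succ n ih =>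
      simp only [altProd, map_mul, lift_apply_simple, Function.End.mul_apply_eq, ih]
      simp only [f, if_true, if_neg hik.symm]
      push_cast
      constructor <;> ring
  intro he
  have h1 := (hpos (n + 1)).1
  rw [he, (hpos (n + 1)).2] at h1
  push_cast at h1
  omega

theorem invCocycle_altProd {i k : I} (hik : i ≠ k) (h : M i k = 0) (n : ℕ) :
    cs.invCocycle hM (cs.altProd i k n) (cs.simple k) = 0 := by
  induction n with
  | zero => simp [altProd, invCocycle_one]
  | succ n ih =>
    obtain ⟨j, -, hj⟩ := cs.exists_altProd_succ n i k
    rw [hj, invCocycle_mul, ih, zero_add, invCocycle_simple, if_neg]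
    intro he
    -- If the last letter crossed the wall of `k`, the word of length `n + 1` starting with `i`
    -- would equal the one starting with `k`.
    refine cs.altProd_ne hM hik h n ?_
    rw [hj, ← he, altProd]
    simp [mul_assoc]

theorem exists_altProd_of_mem_closure {i k : I} {v : W}
    (hv : v ∈ Subgroup.closure {cs.simple i, cs.simple k}) :
    ∃ n, v = cs.altProd i k n ∨ v = cs.altProd k i n := by
  have step : ∀ (a b : I) (w : W), (∃ n, w = cs.altProd a b n ∨ w = cs.altProd b a n) →
      ∃ n, cs.simple a * w = cs.altProd a b n ∨ cs.simple a * w = cs.altProd b a n := by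
    rintro a b w ⟨n, rfl | rfl⟩
    · cases n with
      | zero => exact ⟨1, Or.inl (by simp [altProd])⟩
      | succ n => exact ⟨n, Or.inr (by simp [altProd])⟩
    · exact ⟨n + 1, Or.inl rfl⟩
  have step' : ∀ w : W, (∃ n, w = cs.altProd i k n ∨ w = cs.altProd k i n) →
      ∀ x ∈ ({cs.simple i, cs.simple k} : Set W),
      ∃ n, x * w = cs.altProd i k n ∨ x * w = cs.altProd k i n := by
    intro w hw x hx
    rcases hx with rfl | rfl
    · exact step i k w hw
    · obtain ⟨n, hn⟩ := step k i w (hw.imp fun n => Or.symm)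
      exact ⟨n, hn.symm⟩
  induction hv using Subgroup.closure_induction_left with
  | one => exact ⟨0, Or.inl rfl⟩
  | mul_left x hx y _ ih => exact step' y ih x hx
  | inv_mul_cancel x hx y _ ih =>
    have : x⁻¹ = x := by rcases hx with rfl | rfl <;> exact cs.inv_simple _
    rw [this]
    exact step' y ih x hx

include hM in
/-- Two distinct left descents of one element generate a finite parabolic subgroup. -/
theorem ne_zero_of_isLeftDescent {i k : I} (hik : i ≠ k) {u : W} (hi : cs.IsLeftDescent u i)
    (hk : cs.IsLeftDescent u k) : M i k ≠ 0 := by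
  intro h
  set K := Subgroup.closure {cs.simple i, cs.simple k} with hK
  have hiK : cs.simple i ∈ K := Subgroup.subset_closure (by simp)
  have hkK : cs.simple k ∈ K := Subgroup.subset_closure (by simp)
  -- For `v⁻¹ * u` of least length in the coset `K u`, the cocycle vanishes on `K`. So `u` and `v`
  -- have the same cocycle there, and an alternating word has only one of `i`, `k` as a descent.
  obtain ⟨v, hv⟩ := exists_minimal_of_wellFoundedLT
    (fun n => ∃ v ∈ K, cs.length (v⁻¹ * u) = n) ⟨_, 1, K.one_mem, rfl⟩
  obtain ⟨⟨v, hvK, rfl⟩, hmin⟩ := hv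
  have zero : ∀ t ∈ K, cs.invCocycle hM (v⁻¹ * u) t = 0 := by
    intro t ht
    refine cs.invCocycle_eq_zero_of_ne_one hM fun h1 => ?_
    have h2 := cs.length_mul_lt_of_invCocycle_eq_one hM h1
    have h3 : t * (v⁻¹ * u) = (v * t⁻¹)⁻¹ * u := by simp [mul_assoc]
    rw [h3] at h2
    exact absurd (hmin ⟨v * t⁻¹, K.mul_mem hvK (K.inv_mem ht), rfl⟩ h2.le) (by omega)
  have restr : ∀ t ∈ K, cs.invCocycle hM u t = cs.invCocycle hM v t := by
    intro t ht
    conv_lhs => rw [← mul_inv_cancel_left v u]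
    rw [invCocycle_mul, zero _ (K.mul_mem (K.mul_mem (K.inv_mem hvK) ht) hvK), add_zero]
  rw [cs.isLeftDescent_iff_invCocycle_eq_one hM, restr _ hiK] at hi
  rw [cs.isLeftDescent_iff_invCocycle_eq_one hM, restr _ hkK] at hk
  obtain ⟨n, rfl | rfl⟩ := cs.exists_altProd_of_mem_closure hvK
  · rw [cs.invCocycle_altProd hM hik h] at hk
    exact zero_ne_one hk
  · rw [cs.invCocycle_altProd hM hik.symm (by rw [M.symmetric]; exact h)] at hi
    exact zero_ne_one hi

end Dihedral

end CoxeterSystem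

/-! ### Operations on galleries. -/

namespace ChamberSystem

variable {I C : Type*} {S : ChamberSystem I C}

theorem Adj.symm {i : I} {c d : C} (h : S.Adj i c d) : S.Adj i d c :=
  ⟨h.1.symm, (S.panelSetoid i).symm' h.2⟩

theorem IsGallery.length_eq {c d : C} {f : List I} {γ : List C} (h : S.IsGallery c f γ d) :
    γ.length = f.length + 1 := by
  induction h with
  | nil c => rfl
  | cons _ _ ih => simp [ih]

theorem IsGallery.append {c d e : C} {f g : List I} {γ γ' : List C} (h : S.IsGallery c f γ d)
    (h' : S.IsGallery d g γ' e) : ∃ γ'', S.IsGallery c (f ++ g) γ'' e := by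
  induction h with
  | nil c => exact ⟨γ', h'⟩
  | cons hadj _ ih =>
    obtain ⟨γ'', h''⟩ := ih h'
    exact ⟨_, IsGallery.cons hadj h''⟩

theorem IsGallery.reverse {c d : C} {f : List I} {γ : List C} (h : S.IsGallery c f γ d) :
    ∃ γ', S.IsGallery d f.reverse γ' c := by
  induction h with
  | nil c => exact ⟨_, IsGallery.nil c⟩
  | cons hadj _ ih =>
    obtain ⟨γ', h'⟩ := ih
    rw [List.reverse_cons]
    exact h'.append (IsGallery.cons hadj.symm (IsGallery.nil _))

end ChamberSystem

/-! ### Weyl distance and gallery distance. -/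

namespace Building

open ChamberSystem

variable {I : Type*} {M : CoxeterMatrix I} {C : Type*} (Δ : Building M C)

theorem exists_reduced_gallery (c d : C) : ∃ f γ, M.toCoxeterSystem.IsReduced f ∧
    Δ.δ c d = M.toCoxeterSystem.wordProd f ∧ Δ.IsGallery c f γ d := by
  obtain ⟨f, hf, h⟩ := M.toCoxeterSystem.exists_isReduced (Δ.δ c d)
  obtain ⟨γ, hγ⟩ := (Δ.δ_eq_iff f hf c d).1 h
  exact ⟨f, γ, hf, h, hγ⟩

theorem δ_self (c : C) : Δ.δ c c = 1 := by
  rw [(Δ.δ_eq_iff [] (by simp [CoxeterSystem.IsReduced]) c c).2 ⟨_, IsGallery.nil c⟩]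
  simp

theorem eq_of_δ_eq_one {c d : C} (h : Δ.δ c d = 1) : c = d := by
  obtain ⟨γ, hγ⟩ := (Δ.δ_eq_iff [] (by simp [CoxeterSystem.IsReduced]) c d).1 (by simp [h])
  cases hγ
  rfl

theorem δ_inv (c d : C) : (Δ.δ c d)⁻¹ = Δ.δ d c := by
  obtain ⟨f, γ, hf, h, hγ⟩ := Δ.exists_reduced_gallery c d
  obtain ⟨γ', hγ'⟩ := hγ.reverse
  rw [(Δ.δ_eq_iff f.reverse hf.reverse d c).2 ⟨_, hγ'⟩, h, CoxeterSystem.wordProd_reverse]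

theorem δ_eq_simple_mul {i : I} {c d e : C} (h : Δ.Adj i c d)
    (hd : ¬ M.toCoxeterSystem.IsLeftDescent (Δ.δ d e) i) :
    Δ.δ c e = M.toCoxeterSystem.simple i * Δ.δ d e := by
  obtain ⟨f, γ, hf, hδ, hγ⟩ := Δ.exists_reduced_gallery d e
  rw [CoxeterSystem.not_isLeftDescent_iff, hδ, hf.eq] at hd
  rw [hδ, ← CoxeterSystem.wordProd_cons]
  exact (Δ.δ_eq_iff (i :: f) (by rw [CoxeterSystem.IsReduced, CoxeterSystem.wordProd_cons, hd]; rfl)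
    c e).2 ⟨_, IsGallery.cons h hγ⟩

theorem exists_adj_of_isLeftDescent {i : I} {c e : C}
    (h : M.toCoxeterSystem.IsLeftDescent (Δ.δ c e) i) :
    ∃ d, Δ.Adj i c d ∧ Δ.δ d e = M.toCoxeterSystem.simple i * Δ.δ c e := by
  obtain ⟨f, hf, hw⟩ :=
    M.toCoxeterSystem.exists_isReduced (M.toCoxeterSystem.simple i * Δ.δ c e)
  have hδ : Δ.δ c e = M.toCoxeterSystem.wordProd (i :: f) := by
    rw [CoxeterSystem.wordProd_cons, ← hw, CoxeterSystem.simple_mul_simple_cancel_left]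
  have hred : M.toCoxeterSystem.IsReduced (i :: f) := by
    rw [CoxeterSystem.isLeftDescent_iff, hw, hf.eq] at h
    rw [CoxeterSystem.IsReduced, ← hδ, ← h]
    rfl
  obtain ⟨γ, hγ⟩ := (Δ.δ_eq_iff _ hred c e).1 hδ
  cases hγ with
  | cons hadj hγ' => exact ⟨_, hadj, by rw [hw]; exact (Δ.δ_eq_iff f hf _ e).2 ⟨_, hγ'⟩⟩

theorem δ_eq_or_of_adj {i : I} {c d : C} (h : Δ.Adj i c d) (e : C) :
    Δ.δ c e = M.toCoxeterSystem.simple i * Δ.δ d e ∨ Δ.δ c e = Δ.δ d e := by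
  by_cases hd : M.toCoxeterSystem.IsLeftDescent (Δ.δ d e) i
  · obtain ⟨d', hd', hδ⟩ := Δ.exists_adj_of_isLeftDescent hd
    by_cases hc : c = d'
    · subst hc
      exact Or.inl hδ
    · right
      rw [Δ.δ_eq_simple_mul ⟨hc, (Δ.panelSetoid i).trans' h.2 hd'.2⟩, hδ,
        CoxeterSystem.simple_mul_simple_cancel_left]
      rw [hδ]
      exact CoxeterSystem.isLeftDescent_iff_not_isLeftDescent_mul _ |>.1 hd
  · exact Or.inl (Δ.δ_eq_simple_mul h hd)

theorem δ_eq_or_of_adj_right {i : I} {d e : C} (h : Δ.Adj i d e) (c : C) :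
    Δ.δ c e = Δ.δ c d * M.toCoxeterSystem.simple i ∨ Δ.δ c e = Δ.δ c d := by
  rw [← Δ.δ_inv e c, ← Δ.δ_inv d c]
  rcases Δ.δ_eq_or_of_adj h.symm c with h | h <;> rw [h]
  · rw [mul_inv_rev, CoxeterSystem.inv_simple]
    exact Or.inl rfl
  · exact Or.inr rfl

theorem δ_eq_simple_of_adj {i : I} {c d : C} (h : Δ.Adj i c d) :
    Δ.δ c d = M.toCoxeterSystem.simple i := by
  rw [Δ.δ_eq_simple_mul h, δ_self, mul_one]
  rw [δ_self]
  exact M.toCoxeterSystem.not_isLeftDescent_one i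

/-- The gallery distance between two chambers. -/
noncomputable def dist (c d : C) : ℕ := M.toCoxeterSystem.length (Δ.δ c d)

theorem dist_le_of_isGallery {c d : C} {f : List I} {γ : List C} (h : Δ.IsGallery c f γ d) :
    Δ.dist c d ≤ f.length := by
  unfold dist
  induction h with
  | nil c => simp [δ_self]
  | @cons i f c d e γ hadj _ ih =>
    rw [List.length_cons]
    rcases Δ.δ_eq_or_of_adj hadj e with h | h
    · rw [h]
      rcases M.toCoxeterSystem.length_simple_mul (Δ.δ d e) i <;> omega
    · rw [h]; omega

theorem exists_gallery_length_eq_dist (c d : C) :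
    ∃ f γ, Δ.IsGallery c f γ d ∧ f.length = Δ.dist c d := by
  obtain ⟨f, γ, hf, h, hγ⟩ := Δ.exists_reduced_gallery c d
  exact ⟨f, γ, hγ, by rw [dist, h, hf.eq]⟩

theorem dist_triangle (c d e : C) : Δ.dist c e ≤ Δ.dist c d + Δ.dist d e := by
  obtain ⟨f, γ, hγ, hf⟩ := Δ.exists_gallery_length_eq_dist c d
  obtain ⟨g, γ', hγ', hg⟩ := Δ.exists_gallery_length_eq_dist d e
  obtain ⟨γ'', h⟩ := hγ.append hγ'
  have := Δ.dist_le_of_isGallery h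
  rw [List.length_append] at this
  omega

theorem dist_le_add_one_of_adj {i : I} {c d : C} (h : Δ.Adj i c d) (e : C) :
    Δ.dist c e ≤ Δ.dist d e + 1 := by
  have := Δ.dist_triangle c d e
  have h1 : Δ.dist c d = 1 := by
    rw [dist, Δ.δ_eq_simple_of_adj h, CoxeterSystem.length_simple]
  omega

theorem dist_add_dist_of_mem {c d e : C} {f : List I} {γ : List C} (h : Δ.IsGallery c f γ d)
    (he : e ∈ γ) : Δ.dist c e + Δ.dist e d ≤ f.length := by
  induction h with
  | nil c =>
    rw [List.mem_singleton] at he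
    subst he
    simp [dist, δ_self]
  | @cons i f c c' d γ hadj hγ ih =>
    rcases List.mem_cons.1 he with rfl | he
    · have := Δ.dist_le_of_isGallery (IsGallery.cons hadj hγ)
      simpa [dist, δ_self] using this
    · have h1 := ih he
      have h2 := Δ.dist_le_add_one_of_adj hadj e
      rw [List.length_cons]
      omega

/-! ### Projections to panels and the partitions they define. -/

/-- The chamber `r` is the projection of the chamber `x` to the `i`-panel of `r`. -/
def IsGate (i : I) (r x : C) : Prop := ¬ M.toCoxeterSystem.IsLeftDescent (Δ.δ r x) i

variable {Δ}

theorem exists_isGate (i : I) (c x : C) : ∃ r, (Δ.panelSetoid i) c r ∧ Δ.IsGate i r x := by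
  by_cases h : M.toCoxeterSystem.IsLeftDescent (Δ.δ c x) i
  · obtain ⟨d, hd, hδ⟩ := Δ.exists_adj_of_isLeftDescent h
    refine ⟨d, hd.2, ?_⟩
    rw [IsGate, hδ]
    exact (CoxeterSystem.isLeftDescent_iff_not_isLeftDescent_mul _).1 h
  · exact ⟨c, (Δ.panelSetoid i).refl' c, h⟩

theorem IsGate.dist_eq {i : I} {c r x : C} (h : Δ.IsGate i r x) (hc : Δ.Adj i c r) :
    Δ.dist c x = Δ.dist r x + 1 := by
  rw [dist, Δ.δ_eq_simple_mul hc h]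
  exact (CoxeterSystem.not_isLeftDescent_iff _).1 h

theorem IsGate.eq {i : I} {r r' x : C} (h : Δ.IsGate i r x) (h' : Δ.IsGate i r' x)
    (hr : (Δ.panelSetoid i) r r') : r = r' := by
  by_contra hne
  have h1 := h'.dist_eq ⟨hne, hr⟩
  have h2 := h.dist_eq (ChamberSystem.Adj.symm ⟨hne, hr⟩)
  omega

theorem isGate_of_dist_lt {i : I} {c r x : C} (hc : Δ.Adj i c r)
    (h : Δ.dist r x < Δ.dist c x) : Δ.IsGate i r x := by
  intro hd
  rcases Δ.δ_eq_or_of_adj hc x with h1 | h1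
  · unfold dist at h
    rw [h1] at h
    exact lt_asymm h hd
  · unfold dist at h
    rw [h1] at h
    exact lt_irrefl _ h

variable (Δ) in
/-- The partition of the chambers according to their projections to the `i`-panel of `c`. -/
def branchSetoid (i : I) (c : C) : Setoid C where
  r x y := ∃ r, (Δ.panelSetoid i) c r ∧ Δ.IsGate i r x ∧ Δ.IsGate i r y
  iseqv :=
    { refl := fun x => by
        obtain ⟨r, hr, h⟩ := exists_isGate (Δ := Δ) i c x
        exact ⟨r, hr, h, h⟩
      symm := fun ⟨r, hr, h, h'⟩ => ⟨r, hr, h', h⟩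
      trans := fun ⟨r, hr, h, h'⟩ ⟨r', hr', k, k'⟩ => by
        obtain rfl := h'.eq k ((Δ.panelSetoid i).trans' ((Δ.panelSetoid i).symm' hr) hr')
        exact ⟨r, hr, h, k'⟩ }

theorem branchSetoid_congr {i : I} {c d : C} (h : (Δ.panelSetoid i) c d) :
    Δ.branchSetoid i c = Δ.branchSetoid i d := by
  ext x y
  exact ⟨fun ⟨r, hr, h'⟩ => ⟨r, (Δ.panelSetoid i).trans' ((Δ.panelSetoid i).symm' h) hr, h'⟩,
    fun ⟨r, hr, h'⟩ => ⟨r, (Δ.panelSetoid i).trans' h hr, h'⟩⟩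

/-- If `x ≠ y`, take the panel of `x` on which a minimal gallery to `y` starts: `x` is its own
projection but not that of `y`. -/
theorem eq_of_branchSetoid {x y : C} (h : ∀ i c, Δ.branchSetoid i c x y) : x = y := by
  by_contra hne
  have h1 : Δ.δ x y ≠ 1 := fun h1 => hne (Δ.eq_of_δ_eq_one h1)
  obtain ⟨i, hi⟩ := M.toCoxeterSystem.exists_leftDescent_of_ne_one h1
  obtain ⟨r, hr, hx, hy⟩ := h i x
  have hxx : Δ.IsGate i x x := by
    rw [IsGate, δ_self]
    exact M.toCoxeterSystem.not_isLeftDescent_one i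
  rw [← hxx.eq hx hr] at hy
  exact hy hi

/-! ### Panels with equal partitions. -/

section RightAngled

variable (hM : M.IsRightAngled)
include hM

theorem IsGate.of_adj {i k : I} (hik : i ≠ k) (h : M i k = 2) {r r' x : C} (hr : Δ.Adj k r r')
    (hg : Δ.IsGate i r x) : Δ.IsGate i r' x := by
  unfold IsGate at hg ⊢
  have hne := (M.toCoxeterSystem.simple_injective_of_isRightAngled hM).ne hik
  rcases Δ.δ_eq_or_of_adj hr.symm x with h1 | h1 <;> rw [h1]
  · rwa [M.toCoxeterSystem.isLeftDescent_simple_mul_iff_of_eq_two hM h hne]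
  · exact hg

/-- Completes a square: the gallery of type `[i, k]` through `c` is replaced by one of type `[k,
i]`, since the generators commute. -/
theorem exists_adj_adj {i k : I} (hik : i ≠ k) (h : M i k = 2) {r c c' : C} (hrc : Δ.Adj i r c)
    (hc : Δ.Adj k c c') : ∃ r', Δ.Adj k r r' ∧ Δ.Adj i r' c' := by
  have hne := (M.toCoxeterSystem.simple_injective_of_isRightAngled hM).ne hik
  have hnd : ¬ M.toCoxeterSystem.IsLeftDescent (Δ.δ c c') i := by
    rw [Δ.δ_eq_simple_of_adj hc, CoxeterSystem.IsLeftDescent, CoxeterSystem.length_simple,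
      Nat.lt_one_iff, CoxeterSystem.length_eq_zero_iff]
    intro h1
    rw [eq_inv_of_mul_eq_one_left h1, CoxeterSystem.inv_simple] at hne
    exact hne rfl
  have h1 := Δ.δ_eq_simple_mul hrc hnd
  have h2 : Δ.δ r c' = M.toCoxeterSystem.wordProd [k, i] := by
    rw [h1, Δ.δ_eq_simple_of_adj hc, M.toCoxeterSystem.simple_commute_of_eq_two h]
    simp [CoxeterSystem.wordProd_cons]
  have hred : M.toCoxeterSystem.IsReduced [k, i] := by
    rw [CoxeterSystem.not_isLeftDescent_iff, ← h1, h2, Δ.δ_eq_simple_of_adj hc,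
      CoxeterSystem.length_simple] at hnd
    exact hnd
  obtain ⟨γ, hγ⟩ := (Δ.δ_eq_iff _ hred r c').1 h2
  cases hγ with
  | cons hk hγ' =>
    cases hγ' with
    | cons hi hγ'' =>
      cases hγ''
      exact ⟨_, hk, hi⟩

theorem branchSetoid_le_of_adj {i k : I} (hik : i ≠ k) (h : M i k = 2) {c c' : C}
    (hc : Δ.Adj k c c') : Δ.branchSetoid i c ≤ Δ.branchSetoid i c' := by
  rintro x y ⟨r, hr, hx, hy⟩
  by_cases hrc : r = c
  · subst hrc
    exact ⟨c', (Δ.panelSetoid i).refl' c', hx.of_adj hM hik h hc, hy.of_adj hM hik h hc⟩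
  · obtain ⟨r', hk, hi⟩ := exists_adj_adj hM hik h ⟨hrc, (Δ.panelSetoid i).symm' hr⟩ hc
    exact ⟨r', hi.symm.2, hx.of_adj hM hik h hk, hy.of_adj hM hik h hk⟩

/-- Opposite panels of a residue of rank two define the same partition. -/
theorem branchSetoid_eq_of_adj {i k : I} (hik : i ≠ k) (h : M i k = 2) {c c' : C}
    (hc : Δ.Adj k c c') : Δ.branchSetoid i c = Δ.branchSetoid i c' :=
  le_antisymm (branchSetoid_le_of_adj hM hik h hc) (branchSetoid_le_of_adj hM hik h hc.symm)

omit hM in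
-- The gates make `d` one farther than `c` from `p`, and `c` one farther than `d` from `p'`; as
-- moving from `p` to `p'` changes distances by at most one, all these bounds are attained.
theorem isGate_pair {i j : I} {c d p p' : C} (hp : Δ.Adj j p p') (hcd : Δ.Adj i c d)
    (hc : Δ.IsGate i c p) (hd : Δ.IsGate i d p') :
    Δ.dist d p' = Δ.dist c p ∧ Δ.δ c p' = Δ.δ c p * M.toCoxeterSystem.simple j ∧
      Δ.dist c p' = Δ.dist c p + 1 ∧ M.toCoxeterSystem.IsLeftDescent (Δ.δ c p') i := by
  have e1 := hc.dist_eq hcd.symm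
  have e2 := hd.dist_eq hcd
  have r1 := Δ.δ_eq_or_of_adj_right hp c
  have l1 : Δ.dist c p' ≤ Δ.dist c p + 1 := by
    unfold dist
    rcases r1 with h | h <;> rw [h]
    · rcases M.toCoxeterSystem.length_mul_simple (Δ.δ c p) j <;> omega
    · omega
  have l2 : Δ.dist d p ≤ Δ.dist d p' + 1 := by
    unfold dist
    rcases Δ.δ_eq_or_of_adj_right hp.symm d with h | h <;> rw [h]
    · rcases M.toCoxeterSystem.length_mul_simple (Δ.δ d p') j <;> omega
    · omega
  refine ⟨by omega, r1.resolve_right fun h => ?_, by omega, ?_⟩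
  · have : Δ.dist c p' = Δ.dist c p := by rw [dist, h, dist]
    omega
  · unfold dist at e2
    rw [CoxeterSystem.isLeftDescent_iff, e2, Δ.δ_eq_simple_mul hcd hd,
      CoxeterSystem.simple_mul_simple_cancel_left]

/-- Two panels that contain distinct projections of chambers of each other define the same
partition. -/
theorem branchSetoid_eq_of_isGate {i j : I} {p p' : C} (hp : Δ.Adj j p p') (n : ℕ) :
    ∀ {c d : C}, Δ.Adj i c d → Δ.IsGate i c p → Δ.IsGate i d p' → Δ.dist c p = n →
      Δ.branchSetoid i c = Δ.branchSetoid j p := by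
  have hinj := M.toCoxeterSystem.simple_injective_of_isRightAngled hM
  induction n with
  | zero =>
    intro c d hcd hc hd hn
    have hn' : Δ.dist d p' = 0 := (isGate_pair hp hcd hc hd).1.trans hn
    obtain rfl : c = p := Δ.eq_of_δ_eq_one (by rwa [dist, CoxeterSystem.length_eq_zero_iff] at hn)
    obtain rfl : d = p' :=
      Δ.eq_of_δ_eq_one (by rwa [dist, CoxeterSystem.length_eq_zero_iff] at hn')
    obtain rfl : i = j := hinj (by rw [← Δ.δ_eq_simple_of_adj hcd, ← Δ.δ_eq_simple_of_adj hp])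
    rfl
  | succ n ih =>
    intro c d hcd hc hd hn
    obtain ⟨-, hp', hlen, hi⟩ := isGate_pair hp hcd hc hd
    have hne : Δ.δ c p ≠ 1 := by
      rw [Ne, ← M.toCoxeterSystem.length_eq_zero_iff]
      unfold dist at hn
      omega
    -- Here `k` starts a minimal gallery from `c` to `p`. Both `i` and `k` are descents of `δ c p'`,
    -- hence `M i k = 2`, and the panel of `c` moves along `k` one step closer to `p`.
    obtain ⟨k, hk⟩ := M.toCoxeterSystem.exists_leftDescent_of_ne_one hne
    obtain ⟨c', hcc', hδ⟩ := Δ.exists_adj_of_isLeftDescent hk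
    have hik : i ≠ k := by
      rintro rfl
      exact hc hk
    rw [CoxeterSystem.isLeftDescent_iff] at hk
    unfold dist at hn hlen
    have hk' : M.toCoxeterSystem.IsLeftDescent (Δ.δ c p') k := by
      rw [CoxeterSystem.IsLeftDescent, hlen, hp', ← mul_assoc]
      rcases M.toCoxeterSystem.length_mul_simple (M.toCoxeterSystem.simple k * Δ.δ c p) j <;> omega
    have h2 : M i k = 2 :=
      (hM i k hik).resolve_right (M.toCoxeterSystem.ne_zero_of_isLeftDescent hM hik hi hk')
    obtain ⟨d', hdd', hdc'⟩ := exists_adj_adj hM hik h2 hcd.symm hcc'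
    rw [branchSetoid_eq_of_adj hM hik h2 hcc']
    refine ih hdc'.symm (hc.of_adj hM hik h2 hcc') (hd.of_adj hM hik h2 hdd') ?_
    rw [dist, hδ]
    omega

theorem branchSetoid_eq_of_not {i j : I} {c d p : C} (hcd : Δ.Adj i c d)
    (h : ¬ Δ.branchSetoid j p c d) : Δ.branchSetoid j p = Δ.branchSetoid i c := by
  obtain ⟨r, hr, hrc⟩ := exists_isGate (Δ := Δ) j p c
  obtain ⟨r', hr', hrd⟩ := exists_isGate (Δ := Δ) j p d
  have hne : r ≠ r' := by
    rintro rfl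
    exact h ⟨r, hr, hrc, hrd⟩
  have hadj : Δ.Adj j r r' :=
    ⟨hne, (Δ.panelSetoid j).trans' ((Δ.panelSetoid j).symm' hr) hr'⟩
  rw [branchSetoid_congr hr]
  exact branchSetoid_eq_of_isGate hM hcd _ hadj hrc hrd rfl

/-! ### Finiteness and convexity. -/

theorem finite_setOf_branchSetoid_not (c d : C) :
    {W : Setoid C | (∃ i p, W = Δ.branchSetoid i p) ∧ ¬ W c d}.Finite := by
  obtain ⟨f, γ, hγ, -⟩ := Δ.exists_gallery_length_eq_dist c d
  induction hγ with
  | nil c =>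
    refine Set.finite_empty.subset ?_
    rintro W ⟨-, hW⟩
    exact hW (W.refl' c)
  | @cons i f c d e γ hadj hγ ih =>
    -- The first step of the gallery crosses at most the partition of its own panel.
    refine (ih.insert (Δ.branchSetoid i c)).subset ?_
    rintro W ⟨⟨j, p, rfl⟩, hW⟩
    by_cases h : Δ.branchSetoid j p c d
    · exact Or.inr ⟨⟨j, p, rfl⟩, fun h' => hW ((Δ.branchSetoid j p).trans' h h')⟩
    · exact Or.inl (branchSetoid_eq_of_not hM hadj h)

omit hM in
theorem exists_adj_not_rel {W : Setoid C} {c e : C} {f : List I} {γ : List C}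
    (hγ : Δ.IsGallery c f γ e) (hW : ¬ W c e) :
    ∃ i a b, Δ.Adj i a b ∧ ¬ W a b ∧ Δ.dist c a + 1 + Δ.dist b e ≤ f.length := by
  induction hγ with
  | nil c => exact absurd (W.refl' c) hW
  | @cons i f c d e γ hadj hγ ih =>
    rw [List.length_cons]
    by_cases h : W c d
    · obtain ⟨j, a, b, hab, hn, hl⟩ := ih fun h' => hW (W.trans' h h')
      have := Δ.dist_le_add_one_of_adj hadj a
      exact ⟨j, a, b, hab, hn, by omega⟩
    · have := Δ.dist_le_of_isGallery hγ
      refine ⟨i, c, d, hadj, h, ?_⟩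
      rw [dist, δ_self, CoxeterSystem.length_one]
      omega

/-- A minimal gallery leaves the branch of its first chamber only to the branch of the last. -/
theorem branchSetoid_or_of_isMinimalGallery {j : I} {p c d e : C} {γ : List C}
    (hγ : Δ.IsMinimalGallery c γ d) (he : e ∈ γ) :
    Δ.branchSetoid j p c e ∨ Δ.branchSetoid j p e d := by
  by_contra! h
  obtain ⟨⟨f, hf⟩, hmin⟩ := hγ
  obtain ⟨g, γ', hg, hg'⟩ := Δ.exists_gallery_length_eq_dist c d
  have h1 := hmin g γ' hg
  rw [hf.length_eq, hg.length_eq] at h1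
  have h2 := Δ.dist_add_dist_of_mem hf he
  obtain ⟨g₁, γ₁, hg₁, hl₁⟩ := Δ.exists_gallery_length_eq_dist c e
  obtain ⟨i, a, b, hab, hn, hl⟩ := exists_adj_not_rel hg₁ h.1
  have t1 := Δ.dist_triangle c a d
  have t2 := Δ.dist_triangle b e d
  have t3 := Δ.dist_triangle c a e
  have t4 := Δ.dist_triangle c e d
  -- Distances add up along `c`, `a`, `b`, `e`, `d`, so `b` is nearer than `a` to both `e` and `d`;
  -- `e` and `d` then lie in the branch of `b`.
  have hbe : Δ.IsGate i b e := isGate_of_dist_lt hab (by omega)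
  have hbd : Δ.IsGate i b d := isGate_of_dist_lt hab (by omega)
  refine h.2 ?_
  rw [branchSetoid_eq_of_not hM hab hn]
  exact ⟨b, hab.2, hbe, hbd⟩

theorem exists_finite_isConvex (F : Set C) (hF : F.Finite) :
    ∃ B : Set C, F ⊆ B ∧ B.Finite ∧ Δ.toChamberSystem.IsConvex B := by
  rcases F.eq_empty_or_nonempty with rfl | ⟨f₀, hf₀⟩
  · exact ⟨∅, subset_rfl, Set.finite_empty, fun c hc => hc.elim⟩
  refine ⟨{x | ∀ i p, ∃ f ∈ F, Δ.branchSetoid i p x f}, ?_, ?_, ?_⟩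
  · exact fun f hf i p => ⟨f, hf, (Δ.branchSetoid i p).refl' f⟩
  · set T : Set (Setoid C) :=
      {W | (∃ i p, W = Δ.branchSetoid i p) ∧ ∃ f ∈ F, ¬ W f₀ f}
    have hTfin : T.Finite := by
      refine (hF.biUnion fun f _ => finite_setOf_branchSetoid_not (Δ := Δ) hM f₀ f).subset ?_
      rintro W ⟨hW, f, hf, hWf⟩
      exact Set.mem_biUnion hf ⟨hW, hWf⟩
    have := hTfin.to_subtype
    have := hF.to_subtype
    have hrep : ∀ x : {x : C | ∀ i p, ∃ f ∈ F, Δ.branchSetoid i p x f}, ∀ W : T,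
        ∃ f : F, W.1 x.1 f.1 := by
      rintro ⟨x, hx⟩ ⟨W, ⟨i, p, rfl⟩, hW⟩
      obtain ⟨f, hf, h⟩ := hx i p
      exact ⟨⟨f, hf⟩, h⟩
    -- `φ x` records, for each partition separating `F`, a member of `F` in the branch of `x`; there
    -- are finitely many such records.
    choose φ hφ using hrep
    refine Set.finite_coe_iff.1 (Finite.of_injective φ ?_)
    intro x y hxy
    refine Subtype.ext (eq_of_branchSetoid (Δ := Δ) fun i p => ?_)
    by_cases h : Δ.branchSetoid i p ∈ T
    · have h1 := hφ x ⟨_, h⟩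
      rw [hxy] at h1
      exact (Δ.branchSetoid i p).trans' h1 ((Δ.branchSetoid i p).symm' (hφ y ⟨_, h⟩))
    -- Outside `T` all of `F` lies in one branch, which therefore contains `x` and `y`.
    · have hall : ∀ f ∈ F, Δ.branchSetoid i p f₀ f := by
        intro f hf
        by_contra hne
        exact h ⟨⟨i, p, rfl⟩, f, hf, hne⟩
      obtain ⟨f, hf, hx⟩ := x.2 i p
      obtain ⟨g, hg, hy⟩ := y.2 i p
      exact (Δ.branchSetoid i p).trans' hx ((Δ.branchSetoid i p).trans'
        ((Δ.branchSetoid i p).symm' (hall f hf))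
        ((Δ.branchSetoid i p).trans' (hall g hg) ((Δ.branchSetoid i p).symm' hy)))
  · intro c hc d hd γ hγ e he i p
    rcases branchSetoid_or_of_isMinimalGallery (j := i) (p := p) hM hγ he with h | h
    · obtain ⟨f, hf, hcf⟩ := hc i p
      exact ⟨f, hf, (Δ.branchSetoid i p).trans' ((Δ.branchSetoid i p).symm' h) hcf⟩
    · obtain ⟨f, hf, hdf⟩ := hd i p
      exact ⟨f, hf, (Δ.branchSetoid i p).trans' h hdf⟩

end RightAngled

end Building

theorem mainTheorem11 {I : Type u} [Finite I] (M : CoxeterMatrix I)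
    (hM : M.IsRightAngled) {C : Type v} (Δ : Building M C) (q : I → Cardinal.{v})
    (hq : Δ.toChamberSystem.IsSemiregular q) (F : Set C) (hF : F.Finite) :
    ∃ B : Set C, F ⊆ B ∧ B.Finite ∧ Δ.toChamberSystem.IsConvex B := by
  exact Building.exists_finite_isConvex hM F hF
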